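/- **Conventions.** A morphism of probability spaces is a measurable measure-preserving map. A *projective system of probability spaces* over a directed set $(\mathcal I,\le)$ consists of probability spaces $(\Omega_i,\mathcal F_i,\mu_i)$ and morphisms $T_{i,j}:\Omega_j\to\Omega_i$ ($i\le j$) with $T_{i,j}T_{j,k}=T_{i,k}$ for $i\le j\le k$ and $T_{i,i}=\mathrm{id}$. Given probability spaces and maps $T_{i,j}$ over $(\mathcal I,\le)$, let $\Omega=\{(\omega_i)\in\prod_i\Omega_i: T_{i,j}(\omega_j)=\omega_i \text{ for all } i\le j\}$ be the set of threads, with coordinate projections $T_i$. The system is *convergent* if $\Omega\ne\emptyset$, all $T_i$ are surjective, and the set function $T_i^{-1}(A)\mapsto\mu_i(A)$ is $\sigma$-additive on the field $\bigcup_iT_i^{-1}(\mathcal F_i)$; its *projective limit* is then $\Omega$ with the $\sigma$-field generated by the $T_i$ and the extension of this set function to a probability measure. **Convolution systems.** Let $(\mathbb S,\le)$ be a linearly ordered set. A convolution system $\mathscr S=\{\Omega_{s,t},\mathcal F_{s,t},\mu_{s,t},T_{r,s,t}\}_{\mathbb S}$ consists of probability spaces $\Omega_{s,t}$ ($s<t$)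 and morphisms $T_{r,s,t}:\Omega_{r,s}\times\Omega_{s,t}\to\Omega_{r,t}$ ($r<s<t$) that are associative: $T_{r,t,u}(T_{r,s,t}\times\mathrm{id})=T_{r,s,u}(\mathrm{id}\times T_{s,t,u})$ up to a null set, for $r<s<t<u$. For a finite partition $I=\{s=\iota_0<\dots<\iota_{m+1}=t\}$ of $[s,t]$ let $\Omega_I=\prod_{k=0}^m\Omega_{\iota_k,\iota_{k+1}}$ with the product probability measure. For a refinement $J\supseteq I$ let $T_{I,J}:\Omega_J\to\Omega_I$ be the map whose $k$-th coordinate multiplies, by iterating the maps $T_{a,c,b}$ from left to right, the coordinates belonging to $J\cap[\iota_k,\iota_{k+1}]$. $\mathscr S$ is *convergent* if for all $s<t$ the system $\{\Omega_I,T_{I,J}\}$ over the finite partitions of $[s,t]$, ordered by inclusion, is convergent. Its projective limit is denoted $(\Omega^\flat_{s,t},\mathcal F^\flat_{s,t},\mu^\flat_{s,t})$; for $s=t$ let $\Omega^\flat_{s,s}$ be the one-point probability space (the case of the single partition $\{s\}$ and the empty product). For $r\le s\le t$ let $T^\flat_{r,s,t}:\Omega^\flat_{r,s}\times\Omega^\flat_{s,t}\to\Omega^\flat_{r,t}$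 be the bimeasurable bijection determined by $\big(T^\flat_{r,s,t}(x,y)\big)_I=(x_{I\cap[r,s]},y_{I\cap[s,t]})$ for all partitions $I$ of $[r,t]$ containing $s$ (for $r=s$ or $s=t$ this is the obvious identification). For $u\le s\le t\le v$ put $$T^\flat_{(s,t),(u,v)}=\pi_{(s,t)}\circ(\mathrm{id}_{\Omega^\flat_{u,s}}\times T^\flat_{s,t,v})^{-1}\circ(T^\flat_{u,s,v})^{-1}:\Omega^\flat_{u,v}\to\Omega^\flat_{s,t},$$ where $\pi_{(s,t)}:\Omega^\flat_{u,s}\times\Omega^\flat_{s,t}\times\Omega^\flat_{t,v}\to\Omega^\flat_{s,t}$ is the projection onto the middle factor. **Proposition.** Let $\mathscr S$ be a convergent convolution system over $(\mathbb S,\le)$. Then $\big(\{(\Omega^\flat_{s,t},\mathcal F^\flat_{s,t},\mu^\flat_{s,t})\},\{T^\flat_{(s,t),(u,v)}\}\big)$ is a projective system of probability spaces over the directed set $\mathcal C=\{(s,t): s,t\in\mathbb S,\ s\le t\}$, ordered by $(s,t)\subseteq(u,v)$ if and only if $u\le s\le t\le v$. -/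

import Mathlib

open MeasureTheory

universe u v w

/-! ## Probability spaces and projective systems of probability spaces -/

/-- A probability space: a set with a `σ`-field and a probability measure on it. -/
structure ProbSpace : Type (v + 1) where
  /-- the underlying set -/
  carrier : Type v
  [measurableSpace : MeasurableSpace carrier]
  /-- the probability measure -/
  measure : Measure carrier
  [isProbabilityMeasure : IsProbabilityMeasure measure]

namespace ProbSpace

instance : CoeSort ProbSpace.{v} (Type v) := ⟨ProbSpace.carrier⟩

attribute [instance] ProbSpace.measurableSpace ProbSpace.isProbabilityMeasure

end ProbSpace

/-- The data of a system of probability spaces indexed by a directed set, with connecting maps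
`map : Ω j → Ω i` for `i ≤ j`. The axioms of a projective system are in
`ProbSystem.IsProjective`. -/
structure ProbSystem (ι : Type w) [Preorder ι] [IsDirectedOrder ι] where
  /-- the probability spaces `(Ω i, F i, μ i)` -/
  space : ι → ProbSpace.{v}
  /-- the connecting maps -/
  map : ∀ {i j : ι}, i ≤ j → space j → space i

namespace ProbSystem

variable {ι : Type w} [Preorder ι] [IsDirectedOrder ι]

/-- The system is a projective system of probability spaces: the connecting maps are morphisms of
probability spaces (measurable and measure preserving), compatible with each other, and the map
attached to `i ≤ i` is the identity. -/
structure IsProjective (P : ProbSystem.{v} ι) : Prop where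
  measurePreserving : ∀ {i j : ι} (hij : i ≤ j),
    MeasurePreserving (P.map hij) (P.space j).measure (P.space i).measure
  map_comp : ∀ {i j k : ι} (hij : i ≤ j) (hjk : j ≤ k),
    P.map hij ∘ P.map hjk = P.map (hij.trans hjk)
  map_id : ∀ i : ι, P.map (le_refl i) = id

/-- The projective limit in the category of sets: the set of threads. As a subtype of the product
it carries the `σ`-field generated by the coordinate projections. -/
abbrev Thread (P : ProbSystem.{v} ι) : Type (max w v) :=
  {ω : ∀ i, P.space i // ∀ (i j : ι) (hij : i ≤ j), P.map hij (ω j) = ω i}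

/-- The coordinate projections of the set of threads. -/
def proj (P : ProbSystem.{v} ι) (i : ι) (ω : P.Thread) : P.space i := ω.1 i

/-- The set of threads is nonempty and all coordinate projections are surjective. -/
def SimplyMaximal (P : ProbSystem.{v} ι) : Prop :=
  Nonempty P.Thread ∧ ∀ i, Function.Surjective (P.proj i)

/-- `σ`-additivity, on the field of all sets `(proj i)⁻¹ A` with `A` measurable in `Ω i`, of the
set function `(proj i)⁻¹ A ↦ μ i A`: whenever a member `(proj i)⁻¹ A` of the field is the union
of a sequence of pairwise disjoint members `(proj (k n))⁻¹ (B n)`, one has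
`μ i A = ∑ n, μ (k n) (B n)`. -/
def SigmaAdditive (P : ProbSystem.{v} ι) : Prop :=
  ∀ (i : ι) (A : Set (P.space i)) (k : ℕ → ι) (B : ∀ n, Set (P.space (k n))),
    MeasurableSet A → (∀ n, MeasurableSet (B n)) →
    Pairwise (fun m n => Disjoint (P.proj (k m) ⁻¹' B m) (P.proj (k n) ⁻¹' B n)) →
    P.proj i ⁻¹' A = ⋃ n, P.proj (k n) ⁻¹' B n →
    (P.space i).measure A = ∑' n, (P.space (k n)).measure (B n)

/-- A system is convergent if it is simply maximal and the induced set function on the field of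
cylinder sets is `σ`-additive. -/
structure IsConvergent (P : ProbSystem.{v} ι) : Prop where
  simplyMaximal : P.SimplyMaximal
  sigmaAdditive : P.SigmaAdditive

theorem measurable_proj (P : ProbSystem.{v} ι) (i : ι) : Measurable (P.proj i) :=
  (measurable_pi_apply i).comp measurable_subtype_coe

theorem map_proj (P : ProbSystem.{v} ι) {i j : ι} (hij : i ≤ j) (ω : P.Thread) :
    P.map hij (P.proj j ω) = P.proj i ω := ω.2 i j hij

/-- In a simply maximal system the compatibility relations hold everywhere. -/
theorem SimplyMaximal.map_map {P : ProbSystem.{v} ι} (h : P.SimplyMaximal) {i j k : ι}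
    (hij : i ≤ j) (hjk : j ≤ k) (x : P.space k) :
    P.map hij (P.map hjk x) = P.map (hij.trans hjk) x := by
  obtain ⟨ω, rfl⟩ := h.2 k x
  simp only [map_proj]

/-- The `σ`-additive extension of the set function to the `σ`-field of the set of threads
exists. -/
theorem IsConvergent.exists_measure {P : ProbSystem.{v} ι}
    (hm : ∀ {i j : ι} (hij : i ≤ j), Measurable (P.map hij)) (h : P.IsConvergent) :
    ∃ ν : Measure P.Thread, IsProbabilityMeasure ν ∧
      ∀ (i : ι) (A : Set (P.space i)), MeasurableSet A →
        ν (P.proj i ⁻¹' A) = (P.space i).measure A := by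
  classical
  obtain ⟨ω₀⟩ := h.simplyMaximal.1
  rcases isEmpty_or_nonempty ι with hι | ⟨⟨i₀⟩⟩
  · exact ⟨Measure.dirac ω₀, inferInstance, fun i => hι.elim i⟩
  -- the value of the set function does not depend on the representation of a cylinder set
  have wd : ∀ (i j : ι) (A : Set (P.space i)) (B : Set (P.space j)), MeasurableSet A →
      MeasurableSet B → P.proj i ⁻¹' A = P.proj j ⁻¹' B →
      (P.space i).measure A = (P.space j).measure B := by
    intro i j A B hA hB hAB
    have := h.sigmaAdditive i A (fun _ => j) (fun n => if n = 0 then B else ∅) hA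
      (fun n => by
        by_cases hn : n = 0
        · simpa [hn] using hB
        · simp [hn])
      (fun m n hmn => by
        by_cases hm0 : m = 0
        · have hn0 : n ≠ 0 := fun hn0 => hmn (hm0.trans hn0.symm)
          simp [hn0]
        · simp [hm0])
      (by
        rw [hAB]
        ext ω
        simp only [Set.mem_preimage, Set.mem_iUnion]
        constructor
        · intro hω
          exact ⟨0, by simpa using hω⟩
        · rintro ⟨n, hn⟩
          by_cases hn0 : n = 0
          · simpa [hn0] using hn
          · simp [hn0] at hn)
    rw [this, tsum_eq_single 0]
    · simp
    · intro n hn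
      simp [hn]
  let C : Set (Set P.Thread) :=
    {s | ∃ (i : ι) (A : Set (P.space i)), MeasurableSet A ∧ s = P.proj i ⁻¹' A}
  have two : ∀ s ∈ C, ∀ t ∈ C, ∃ (k : ι) (A B : Set (P.space k)), MeasurableSet A ∧
      MeasurableSet B ∧ s = P.proj k ⁻¹' A ∧ t = P.proj k ⁻¹' B := by
    rintro s ⟨i, A, hA, rfl⟩ t ⟨j, B, hB, rfl⟩
    obtain ⟨k, hik, hjk⟩ := exists_ge_ge i j
    refine ⟨k, P.map hik ⁻¹' A, P.map hjk ⁻¹' B, hm hik hA, hm hjk hB, ?_, ?_⟩ <;>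
    · ext ω
      simp only [Set.mem_preimage, map_proj]
  have hC : IsSetRing C :=
    { empty_mem := ⟨i₀, ∅, MeasurableSet.empty, rfl⟩
      union_mem := by
        intro s t hs ht
        obtain ⟨k, A, B, hA, hB, rfl, rfl⟩ := two s hs t ht
        exact ⟨k, A ∪ B, hA.union hB, rfl⟩
      sdiff_mem := by
        intro s t hs ht
        obtain ⟨k, A, B, hA, hB, rfl, rfl⟩ := two s hs t ht
        exact ⟨k, A \ B, hA.diff hB, rfl⟩ }
  let m : Set P.Thread → ENNReal := fun s =>
    if hs : s ∈ C then (P.space hs.choose).measure hs.choose_spec.choose else 0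
  have hmC : ∀ (i : ι) (A : Set (P.space i)), MeasurableSet A →
      m (P.proj i ⁻¹' A) = (P.space i).measure A := by
    intro i A hA
    have hs : P.proj i ⁻¹' A ∈ C := ⟨i, A, hA, rfl⟩
    simp only [m, dif_pos hs]
    exact (wd _ _ _ _ hA hs.choose_spec.choose_spec.1 hs.choose_spec.choose_spec.2).symm
  let c : AddContent ENNReal C := hC.addContent_of_union m
    (by simpa using hmC i₀ ∅ MeasurableSet.empty)
    (by
      intro s t hs ht hst
      obtain ⟨k, A, B, hA, hB, rfl, rfl⟩ := two s hs t ht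
      rw [← Set.preimage_union, hmC k _ (hA.union hB), hmC k A hA, hmC k B hB]
      refine measure_union ?_ hB
      rw [Set.disjoint_left] at hst ⊢
      intro x hxA hxB
      obtain ⟨ω, rfl⟩ := h.simplyMaximal.2 k x
      exact hst hxA hxB)
  have hc : ∀ s, c s = m s := fun _ => rfl
  have hsub : c.IsSigmaSubadditive := by
    refine isSigmaSubadditive_of_addContent_iUnion_eq_tsum hC ?_
    intro f hf hU hd
    choose k B hB hfB using hf
    obtain ⟨i, A, hA, hAU⟩ := hU
    simp only [hc]
    have h1 : ∀ n, m (f n) = (P.space (k n)).measure (B n) := fun n => by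
      rw [hfB n, hmC _ _ (hB n)]
    simp only [h1]
    rw [hAU, hmC i A hA]
    refine h.sigmaAdditive i A k B hA hB ?_ ?_
    · intro a b hab
      have := hd hab
      simp only [Function.onFun] at this
      rwa [hfB a, hfB b] at this
    · rw [← hAU]
      exact Set.iUnion_congr hfB
  have hgen : (inferInstance : MeasurableSpace P.Thread) = MeasurableSpace.generateFrom C := by
    refine le_antisymm ?_ ?_
    · change MeasurableSpace.comap Subtype.val (⨆ i, MeasurableSpace.comap _ _) ≤ _
      rw [MeasurableSpace.comap_iSup]
      refine iSup_le fun i => ?_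
      rw [MeasurableSpace.comap_comp]
      rintro _ ⟨A, hA, rfl⟩
      exact MeasurableSpace.measurableSet_generateFrom ⟨i, A, hA, rfl⟩
    · refine MeasurableSpace.generateFrom_le ?_
      rintro _ ⟨i, A, hA, rfl⟩
      exact P.measurable_proj i hA
  have key : ∀ (i : ι) (A : Set (P.space i)), MeasurableSet A →
      c.measure hC.isSetSemiring hgen.le hsub (P.proj i ⁻¹' A) = (P.space i).measure A := by
    intro i A hA
    rw [c.measure_eq hC.isSetSemiring hgen hsub ⟨i, A, hA, rfl⟩, hc, hmC i A hA]
  refine ⟨c.measure hC.isSetSemiring hgen.le hsub, ⟨?_⟩, key⟩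
  have := key i₀ Set.univ MeasurableSet.univ
  rwa [Set.preimage_univ, measure_univ (μ := (P.space i₀).measure)] at this

/-- The projective limit `(Ω, F, μ)` of a convergent system with measurable connecting maps: the
set of threads, with the `σ`-field generated by the coordinate projections and with the extension
of the set function `(proj i)⁻¹ A ↦ μ i A` to a probability measure on this `σ`-field (for a
nonempty index set it is unique, the sets `(proj i)⁻¹ A` being a generating `π`-system). -/
noncomputable def limit (P : ProbSystem.{v} ι)
    (hm : ∀ {i j : ι} (hij : i ≤ j), Measurable (P.map hij)) (h : P.IsConvergent) :
    ProbSpace.{max w v} where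
  carrier := P.Thread
  measure := (h.exists_measure hm).choose
  isProbabilityMeasure := (h.exists_measure hm).choose_spec.1

theorem limit_measure (P : ProbSystem.{v} ι)
    (hm : ∀ {i j : ι} (hij : i ≤ j), Measurable (P.map hij)) (h : P.IsConvergent)
    (i : ι) (A : Set (P.space i)) (hA : MeasurableSet A) :
    (P.limit hm h).measure (P.proj i ⁻¹' A) = (P.space i).measure A :=
  (h.exists_measure hm).choose_spec.2 i A hA

end ProbSystem

/-! ## Convolution systems and their partition systems -/

/-- A convolution system over a linearly ordered set `S`: probability spaces `Ω s t` for `s < t`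
and an associative family of morphisms `Ω r s × Ω s t → Ω r t` for `r < s < t`. As for all
relations between maps of probability spaces, associativity is only required up to a set of
measure zero; systems whose multiplication is associative everywhere are a special case. -/
structure ConvolutionSystem (S : Type u) [LinearOrder S] where
  /-- the probability spaces `(Ω s t, F s t, μ s t)` -/
  space : ∀ {s t : S}, s < t → ProbSpace.{v}
  /-- the multiplication `T r s t` -/
  mul : ∀ {r s t : S} (hrs : r < s) (hst : s < t),
    space hrs × space hst → space (hrs.trans hst)
  measurePreserving_mul : ∀ {r s t : S} (hrs : r < s) (hst : s < t),
    MeasurePreserving (mul hrs hst) ((space hrs).measure.prod (space hst).measure)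
      (space (hrs.trans hst)).measure
  mul_assoc : ∀ {r s t u : S} (hrs : r < s) (hst : s < t) (htu : t < u),
    ∀ᵐ p ∂((space hrs).measure.prod ((space hst).measure.prod (space htu).measure)),
      mul (hrs.trans hst) htu (mul hrs hst (p.1, p.2.1), p.2.2) =
        mul hrs (hst.trans htu) (p.1, mul hst htu p.2)

/-- The finite partitions `{s = ι₀ < ι₁ < ⋯ < ιₘ₊₁ = t}` of the interval `[s, t]`, as finite sets,
ordered by inclusion. For `s = t` the only one is `{s}`. -/
abbrev IntervalPartition {S : Type u} [LinearOrder S] (s t : S) : Type u :=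
  {I : Finset S // s ∈ I ∧ t ∈ I ∧ ∀ x ∈ I, s ≤ x ∧ x ≤ t}

namespace IntervalPartition

variable {S : Type u} [LinearOrder S]

instance (s t : S) : IsDirectedOrder (IntervalPartition s t) :=
  ⟨fun I J => ⟨⟨I.1 ∪ J.1, Finset.mem_union_left _ I.2.1, Finset.mem_union_left _ I.2.2.1,
    fun x hx => (Finset.mem_union.1 hx).elim (I.2.2.2 x) (J.2.2.2 x)⟩,
    Finset.subset_union_left, Finset.subset_union_right⟩⟩

/-- The pairs `(ιₖ, ιₖ₊₁)` of consecutive elements of a finite set. -/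
def gaps (I : Finset S) : Finset (S × S) :=
  (I ×ˢ I).filter fun p => p.1 < p.2 ∧ ∀ x ∈ I, ¬(p.1 < x ∧ x < p.2)

theorem mem_gaps {I : Finset S} {p : S × S} :
    p ∈ gaps I ↔ (p.1 ∈ I ∧ p.2 ∈ I) ∧ p.1 < p.2 ∧ ∀ x ∈ I, ¬(p.1 < x ∧ x < p.2) := by
  simp [gaps]

theorem lt_of_mem_gaps {I : Finset S} {p : S × S} (hp : p ∈ gaps I) : p.1 < p.2 :=
  (mem_gaps.1 hp).2.1

/-- The points of `J` strictly between `a` and `b`. -/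
def between (J : Finset S) (a b : S) : Finset S := J.filter fun x => a < x ∧ x < b

theorem mem_between {J : Finset S} {a b x : S} : x ∈ between J a b ↔ x ∈ J ∧ a < x ∧ x < b := by
  simp [between]

theorem gap_max {J : Finset S} {a b : S} (hb : b ∈ J) (h : (between J a b).Nonempty) :
    ((between J a b).max' h, b) ∈ gaps J := by
  have hc := mem_between.1 ((between J a b).max'_mem h)
  refine mem_gaps.2 ⟨⟨hc.1, hb⟩, hc.2.2, fun x hx hx' => ?_⟩
  exact absurd ((between J a b).le_max' x (mem_between.2 ⟨hx, hc.2.1.trans hx'.1, hx'.2⟩))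
    (not_le.2 hx'.1)

theorem gap_of_between_empty {J : Finset S} {a b : S} (ha : a ∈ J) (hb : b ∈ J) (hab : a < b)
    (h : ¬(between J a b).Nonempty) : (a, b) ∈ gaps J :=
  mem_gaps.2 ⟨⟨ha, hb⟩, hab, fun x hx hx' => h ⟨x, mem_between.2 ⟨hx, hx'⟩⟩⟩

theorem card_between_lt {J : Finset S} {a b c : S} (hc : c ∈ between J a b) :
    (between J a c).card < (between J a b).card := by
  have hc' := mem_between.1 hc
  refine Finset.card_lt_card (Finset.ssubset_iff_of_subset ?_ |>.2 ⟨c, hc, ?_⟩)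
  · intro x hx
    have hx' := mem_between.1 hx
    exact mem_between.2 ⟨hx'.1, hx'.2.1, hx'.2.2.trans hc'.2.2⟩
  · exact fun h => lt_irrefl c (mem_between.1 h).2.2

/-- The part `I ∩ [r, s]` of a partition `I` of `[r, t]` containing `s`. -/
def left {r s t : S} (I : IntervalPartition r t) (hs : s ∈ I.1) : IntervalPartition r s :=
  ⟨I.1.filter (· ≤ s), Finset.mem_filter.2 ⟨I.2.1, (I.2.2.2 s hs).1⟩,
    Finset.mem_filter.2 ⟨hs, le_refl s⟩, fun x hx =>
      ⟨(I.2.2.2 x (Finset.mem_filter.1 hx).1).1, (Finset.mem_filter.1 hx).2⟩⟩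

/-- The part `I ∩ [s, t]` of a partition `I` of `[r, t]` containing `s`. -/
def right {r s t : S} (I : IntervalPartition r t) (hs : s ∈ I.1) : IntervalPartition s t :=
  ⟨I.1.filter (s ≤ ·), Finset.mem_filter.2 ⟨hs, le_refl s⟩,
    Finset.mem_filter.2 ⟨I.2.2.1, (I.2.2.2 s hs).2⟩, fun x hx =>
      ⟨(Finset.mem_filter.1 hx).2, (I.2.2.2 x (Finset.mem_filter.1 hx).1).2⟩⟩

/-- The partition `I ∪ {s}` of `[r, t]`. -/
def add {r s t : S} (I : IntervalPartition r t) (hrs : r ≤ s) (hst : s ≤ t) :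
    IntervalPartition r t :=
  ⟨insert s I.1, Finset.mem_insert_of_mem I.2.1, Finset.mem_insert_of_mem I.2.2.1, fun x hx =>
    (Finset.mem_insert.1 hx).elim (fun h => h ▸ ⟨hrs, hst⟩) (I.2.2.2 x)⟩

theorem mem_add {r s t : S} (I : IntervalPartition r t) (hrs : r ≤ s) (hst : s ≤ t) :
    s ∈ (I.add hrs hst).1 := Finset.mem_insert_self s I.1

theorem le_add {r s t : S} (I : IntervalPartition r t) (hrs : r ≤ s) (hst : s ≤ t) :
    I ≤ I.add hrs hst := Finset.subset_insert s I.1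

/-- A partition `I` of `[r, s]` completed to the partition `I ∪ {t}` of `[r, t]`. -/
def addRight {r s t : S} (I : IntervalPartition r s) (hst : s ≤ t) : IntervalPartition r t :=
  ⟨insert t I.1, Finset.mem_insert_of_mem I.2.1, Finset.mem_insert_self t I.1, fun x hx =>
    (Finset.mem_insert.1 hx).elim
      (fun h => ⟨((I.2.2.2 s I.2.2.1).1.trans hst).trans_eq h.symm, h.le⟩)
      fun h => ⟨(I.2.2.2 x h).1, (I.2.2.2 x h).2.trans hst⟩⟩

/-- A partition `I` of `[s, t]` completed to the partition `{r} ∪ I` of `[r, t]`. -/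
def addLeft {r s t : S} (I : IntervalPartition s t) (hrs : r ≤ s) : IntervalPartition r t :=
  ⟨insert r I.1, Finset.mem_insert_self r I.1, Finset.mem_insert_of_mem I.2.2.1, fun x hx =>
    (Finset.mem_insert.1 hx).elim
      (fun h => ⟨h.ge, h.le.trans (hrs.trans (I.2.2.2 s I.2.1).2)⟩)
      fun h => ⟨hrs.trans (I.2.2.2 x h).1, (I.2.2.2 x h).2⟩⟩

theorem gap_left {r s t : S} (I : IntervalPartition r t) (hs : s ∈ I.1) {p : S × S}
    (hp : p ∈ gaps I.1) (h : p.2 ≤ s) : p ∈ gaps (I.left hs).1 := by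
  have hp' := mem_gaps.1 hp
  exact mem_gaps.2 ⟨⟨Finset.mem_filter.2 ⟨hp'.1.1, hp'.2.1.le.trans h⟩,
    Finset.mem_filter.2 ⟨hp'.1.2, h⟩⟩, hp'.2.1, fun x hx => hp'.2.2 x (Finset.mem_filter.1 hx).1⟩

theorem le_of_gap {J : Finset S} {s : S} (hs : s ∈ J) {p : S × S} (hp : p ∈ gaps J)
    (h : ¬p.2 ≤ s) : s ≤ p.1 :=
  not_lt.1 fun h' => (mem_gaps.1 hp).2.2 s hs ⟨h', not_le.1 h⟩

theorem gap_right {r s t : S} (I : IntervalPartition r t) (hs : s ∈ I.1) {p : S × S}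
    (hp : p ∈ gaps I.1) (h : ¬p.2 ≤ s) : p ∈ gaps (I.right hs).1 := by
  have hp' := mem_gaps.1 hp
  exact mem_gaps.2 ⟨⟨Finset.mem_filter.2 ⟨hp'.1.1, le_of_gap hs hp h⟩,
    Finset.mem_filter.2 ⟨hp'.1.2, (not_le.1 h).le⟩⟩, hp'.2.1,
    fun x hx => hp'.2.2 x (Finset.mem_filter.1 hx).1⟩

theorem gap_addRight {r s t : S} (I : IntervalPartition r s) (hst : s ≤ t) {p : S × S}
    (hp : p ∈ gaps I.1) : p ∈ gaps (I.addRight hst).1 := by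
  have hp' := mem_gaps.1 hp
  refine mem_gaps.2 ⟨⟨Finset.mem_insert_of_mem hp'.1.1, Finset.mem_insert_of_mem hp'.1.2⟩,
    hp'.2.1, fun x hx => ?_⟩
  rcases Finset.mem_insert.1 hx with rfl | hx
  · exact fun h => absurd h.2 (not_lt.2 ((I.2.2.2 _ hp'.1.2).2.trans hst))
  · exact hp'.2.2 x hx

theorem gap_addLeft {r s t : S} (I : IntervalPartition s t) (hrs : r ≤ s) {p : S × S}
    (hp : p ∈ gaps I.1) : p ∈ gaps (I.addLeft hrs).1 := by
  have hp' := mem_gaps.1 hp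
  refine mem_gaps.2 ⟨⟨Finset.mem_insert_of_mem hp'.1.1, Finset.mem_insert_of_mem hp'.1.2⟩,
    hp'.2.1, fun x hx => ?_⟩
  rcases Finset.mem_insert.1 hx with rfl | hx
  · exact fun h => absurd h.1 (not_lt.2 (hrs.trans (I.2.2.2 _ hp'.1.1).1))
  · exact hp'.2.2 x hx

end IntervalPartition

namespace ConvolutionSystem

open IntervalPartition

variable {S : Type u} [LinearOrder S] (𝒮 : ConvolutionSystem.{u, v} S)

/-- The product probability space `Ω_I = ∏ₖ Ω ιₖ ιₖ₊₁` over the consecutive pairs of `I`. (For a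
one-point set `I` this is the empty product, a one-point space.) -/
noncomputable def partSpace (I : Finset S) : ProbSpace.{max u v} where
  carrier := ∀ p : gaps I, 𝒮.space (lt_of_mem_gaps p.2)
  measure := Measure.pi fun p : gaps I => (𝒮.space (lt_of_mem_gaps p.2)).measure

variable {𝒮} in
/-- For `a < b` in `J`, the map `Ω_J → Ω a b` which multiplies the coordinates of a point of `Ω_J`
that lie between `a` and `b`. If `c` is the last point of `J` strictly between `a` and `b`, this
is the product of the map for `a < c` and of the coordinate `(c, b)`; if there is no such point
it is the coordinate `(a, b)`. -/
noncomputable def compose {J : Finset S} (ω : 𝒮.partSpace J) {a : S} (ha : a ∈ J) :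
    ∀ {b : S} (_ : b ∈ J) (hab : a < b), 𝒮.space hab := fun {b} hb hab =>
  if h : (between J a b).Nonempty then
    have hc := mem_between.1 ((between J a b).max'_mem h)
    𝒮.mul hc.2.1 hc.2.2 (compose ω ha hc.1 hc.2.1, ω ⟨((between J a b).max' h, b), gap_max hb h⟩)
  else ω ⟨(a, b), gap_of_between_empty ha hb hab h⟩
termination_by b => (between J a b).card
decreasing_by exact card_between_lt ((between J a b).max'_mem h)

/-- The system `{Ω_I, T I J}` over the finite partitions of `[s, t]`. The `k`-th coordinate of
`T I J` is the composition of the coordinates between `ιₖ` and `ιₖ₊₁`. -/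
noncomputable def partitionSystem (s t : S) :
    ProbSystem.{max u v} (IntervalPartition s t) where
  space I := 𝒮.partSpace I.1
  map hIJ ω := fun p =>
    compose ω (hIJ (mem_gaps.1 p.2).1.1) (hIJ (mem_gaps.1 p.2).1.2) (lt_of_mem_gaps p.2)

/-- A convolution system is convergent if for all `s < t` the system over the finite partitions
of `[s, t]` is convergent. -/
def IsConvergent : Prop := ∀ s t : S, s < t → (𝒮.partitionSystem s t).IsConvergent

variable {𝒮}

theorem measurable_compose {J : Finset S} {a : S} (ha : a ∈ J) : ∀ (n : ℕ) {b : S} (hb : b ∈ J)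
    (hab : a < b), (between J a b).card = n →
      Measurable fun ω : 𝒮.partSpace J => compose ω ha hb hab := by
  intro n
  induction n using Nat.strong_induction_on with
  | _ n ih =>
    intro b hb hab hn
    by_cases h : (between J a b).Nonempty
    · have hc := mem_between.1 ((between J a b).max'_mem h)
      have h1 : (fun ω : 𝒮.partSpace J => compose ω ha hb hab) = fun ω =>
          𝒮.mul hc.2.1 hc.2.2 (compose ω ha hc.1 hc.2.1,
            ω ⟨((between J a b).max' h, b), gap_max hb h⟩) := by
        funext ω
        rw [compose, dif_pos h]
      rw [h1]
      refine (𝒮.measurePreserving_mul _ _).measurable.comp (Measurable.prodMk ?_ ?_)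
      · exact ih _ (hn ▸ card_between_lt ((between J a b).max'_mem h)) hc.1 hc.2.1 rfl
      · exact measurable_pi_apply _
    · have h1 : (fun ω : 𝒮.partSpace J => compose ω ha hb hab) = fun ω =>
          ω ⟨(a, b), gap_of_between_empty ha hb hab h⟩ := by
        funext ω
        rw [compose, dif_neg h]
      rw [h1]
      exact measurable_pi_apply _

theorem measurable_partitionSystem_map {s t : S} {I J : IntervalPartition s t} (hIJ : I ≤ J) :
    Measurable ((𝒮.partitionSystem s t).map hIJ) :=
  measurable_pi_iff.2 fun _ => measurable_compose _ _ _ _ rfl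

/-- For a one-point interval the system consists of a single one-point space, and it is
convergent. -/
theorem isConvergent_partitionSystem_self (s : S) : (𝒮.partitionSystem s s).IsConvergent := by
  have hg : ∀ (I : IntervalPartition s s) (p : S × S), p ∉ gaps I.1 := by
    intro I p hp
    have hp' := mem_gaps.1 hp
    exact absurd hp'.2.1 (not_lt.2 ((I.2.2.2 _ hp'.1.2).2.trans (I.2.2.2 _ hp'.1.1).1))
  have hsub : ∀ (I : IntervalPartition s s) (x y : (𝒮.partitionSystem s s).space I), x = y :=
    fun I x y => funext fun p => (hg I p.1 p.2).elim
  have hI : ∀ I J : IntervalPartition s s, I = J := by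
    intro I J
    have h1 : ∀ K : IntervalPartition s s, K.1 = {s} := fun K =>
      Finset.eq_singleton_iff_unique_mem.2
        ⟨K.2.1, fun x hx => le_antisymm (K.2.2.2 x hx).2 (K.2.2.2 x hx).1⟩
    exact Subtype.ext ((h1 I).trans (h1 J).symm)
  have hsurj : ∀ I, Function.Surjective ((𝒮.partitionSystem s s).proj I) := fun I x =>
    ⟨⟨fun J p => (hg J p.1 p.2).elim, fun J K _ => hsub J _ _⟩, hsub I _ _⟩
  refine ⟨⟨⟨fun J p => (hg J p.1 p.2).elim, fun J K _ => hsub J _ _⟩, hsurj⟩, ?_⟩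
  intro i A k B hA hB hd hU
  obtain rfl : k = fun _ => i := funext fun n => hI _ _
  rw [← Set.preimage_iUnion] at hU
  rw [(hsurj i).preimage_injective hU]
  refine measure_iUnion (fun m n hmn => ?_) hB
  have := hd hmn
  simp only [Set.disjoint_left] at this
  refine Set.disjoint_left.2 fun x hx hx' => ?_
  obtain ⟨ω, rfl⟩ := hsurj i x
  exact this hx hx'

theorem IsConvergent.partitionSystem (h : 𝒮.IsConvergent) {s t : S} (hst : s ≤ t) :
    (𝒮.partitionSystem s t).IsConvergent := by
  rcases hst.lt_or_eq with hlt | rfl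
  · exact h s t hlt
  · exact isConvergent_partitionSystem_self s

/-! ## The projective limits and their multiplication -/

/-- The projective limit `(Ω♭ s t, F♭ s t, μ♭ s t)` of the system over the finite partitions of
`[s, t]`. For `s = t` it is a one-point space. -/
noncomputable def flat (h : 𝒮.IsConvergent) {s t : S} (hst : s ≤ t) : ProbSpace.{max u v} :=
  (𝒮.partitionSystem s t).limit measurable_partitionSystem_map (h.partitionSystem hst)

theorem compose_gap {J : Finset S} (ω : 𝒮.partSpace J) {p : S × S} (hp : p ∈ gaps J)
    (ha : p.1 ∈ J) (hb : p.2 ∈ J) (hab : p.1 < p.2) : compose ω ha hb hab = ω ⟨p, hp⟩ := by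
  have h : ¬(between J p.1 p.2).Nonempty := fun ⟨x, hx⟩ =>
    (mem_gaps.1 hp).2.2 x (mem_between.1 hx).1 (mem_between.1 hx).2
  rw [compose, dif_neg h]

theorem compose_mul {J : Finset S} (ω : 𝒮.partSpace J) {a b c : S} (ha : a ∈ J) (hb : b ∈ J)
    (hab : a < b) (hc : c ∈ J) (hac : a < c) (hcb : c < b) (hg : (c, b) ∈ gaps J) :
    compose ω ha hb hab = 𝒮.mul hac hcb (compose ω ha hc hac, ω ⟨(c, b), hg⟩) := by
  have hmem : c ∈ between J a b := mem_between.2 ⟨hc, hac, hcb⟩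
  have h : (between J a b).Nonempty := ⟨c, hmem⟩
  have hm := mem_between.1 ((between J a b).max'_mem h)
  obtain rfl : c = (between J a b).max' h := by
    refine ((between J a b).le_max' c hmem).eq_or_lt.resolve_right fun hlt => ?_
    exact (mem_gaps.1 hg).2.2 _ hm.1 ⟨hlt, hm.2.2⟩
  rw [compose, dif_pos h]

/-- `compose ω a b` depends only on the points of the finite set in `[a, b]` and on the
coordinates of `ω` there. -/
theorem compose_congr {J K : Finset S} (ω : 𝒮.partSpace J) (ω' : 𝒮.partSpace K) {a : S}
    (ha : a ∈ J) (ha' : a ∈ K) : ∀ (n : ℕ) {b : S} (hb : b ∈ J) (hb' : b ∈ K) (hab : a < b),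
      (between J a b).card = n → (∀ x, a ≤ x → x ≤ b → (x ∈ J ↔ x ∈ K)) →
      (∀ (p : S × S) (hp : p ∈ gaps J) (hp' : p ∈ gaps K), a ≤ p.1 → p.2 ≤ b →
        ω ⟨p, hp⟩ = ω' ⟨p, hp'⟩) →
      compose ω ha hb hab = compose ω' ha' hb' hab := by
  intro n
  induction n using Nat.strong_induction_on with
  | _ n ih =>
    intro b hb hb' hab hn hJK hω
    have gapK : ∀ c, a ≤ c → (c, b) ∈ gaps J → (c, b) ∈ gaps K := by
      intro c hac hg
      have hg' := mem_gaps.1 hg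
      refine mem_gaps.2 ⟨⟨(hJK c hac hg'.2.1.le).1 hg'.1.1, hb'⟩, hg'.2.1, fun x hx hx' => ?_⟩
      exact hg'.2.2 x ((hJK x (hac.trans hx'.1.le) hx'.2.le).2 hx) hx'
    by_cases h : (between J a b).Nonempty
    · have hmem := (between J a b).max'_mem h
      have hc := mem_between.1 hmem
      have hg := gap_max hb h
      generalize (between J a b).max' h = c at hmem hc hg
      have hcK := (hJK c hc.2.1.le hc.2.2.le).1 hc.1
      rw [compose_mul ω ha hb hab hc.1 hc.2.1 hc.2.2 hg,
        compose_mul ω' ha' hb' hab hcK hc.2.1 hc.2.2 (gapK c hc.2.1.le hg),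
        hω _ hg (gapK c hc.2.1.le hg) hc.2.1.le (le_refl b),
        ih _ (hn ▸ card_between_lt hmem) hc.1 hcK hc.2.1 rfl
          (fun x h1 h2 => hJK x h1 (h2.trans hc.2.2.le))
          (fun p hp hp' h1 h2 => hω p hp hp' h1 (h2.trans hc.2.2.le))]
    · have hg := gap_of_between_empty ha hb hab h
      rw [compose_gap ω (p := (a, b)) hg, compose_gap ω' (p := (a, b)) (gapK a (le_refl a) hg)]
      exact hω _ hg _ (le_refl a) (le_refl b)

/-- The coordinates of a thread at `I` and at a refinement `J` agree on common consecutive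
pairs. -/
theorem thread_gap {s t : S} (x : (𝒮.partitionSystem s t).Thread) {I J : IntervalPartition s t}
    (hIJ : I ≤ J) {p : S × S} (hp : p ∈ gaps I.1) (hp' : p ∈ gaps J.1) :
    x.1 I ⟨p, hp⟩ = x.1 J ⟨p, hp'⟩ := by
  rw [← x.2 I J hIJ]
  exact compose_gap _ hp' _ _ _

/-- The point `(x_{I ∩ [r, s]}, y_{I ∩ [s, t]})` of
`Ω_I = Ω_{I ∩ [r, s]} × Ω_{I ∩ [s, t]}`, for a partition `I` of `[r, t]` containing `s` and
threads `x` over `[r, s]` and `y` over `[s, t]`. -/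
noncomputable def glue {r s t : S} (x : (𝒮.partitionSystem r s).Thread)
    (y : (𝒮.partitionSystem s t).Thread) (I : IntervalPartition r t) (hs : s ∈ I.1) :
    𝒮.partSpace I.1 := fun p =>
  if h : p.1.2 ≤ s then x.1 (I.left hs) ⟨p.1, gap_left I hs p.2 h⟩
  else y.1 (I.right hs) ⟨p.1, gap_right I hs p.2 h⟩

theorem map_glue {r s t : S} (x : (𝒮.partitionSystem r s).Thread)
    (y : (𝒮.partitionSystem s t).Thread) {I J : IntervalPartition r t} (hIJ : I ≤ J)
    (hI : s ∈ I.1) (hJ : s ∈ J.1) :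
    (𝒮.partitionSystem r t).map hIJ (glue x y J hJ) = glue x y I hI := by
  funext ⟨p, hp⟩
  have hp' := mem_gaps.1 hp
  by_cases h : p.2 ≤ s
  · have hL : I.left hI ≤ J.left hJ := fun z hz =>
      Finset.mem_filter.2 ⟨hIJ (Finset.mem_filter.1 hz).1, (Finset.mem_filter.1 hz).2⟩
    have h1 : glue x y I hI ⟨p, hp⟩ = x.1 (I.left hI) ⟨p, gap_left I hI hp h⟩ := dif_pos h
    rw [h1, ← x.2 _ _ hL]
    refine compose_congr _ _ _ _ _ _ _ _ rfl ?_ ?_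
    · intro z _ hz
      exact ⟨fun hzJ => Finset.mem_filter.2 ⟨hzJ, hz.trans h⟩, fun hz => (Finset.mem_filter.1 hz).1⟩
    · intro q hq hq' _ hq2
      exact dif_pos (hq2.trans h)
  · have hR : I.right hI ≤ J.right hJ := fun z hz =>
      Finset.mem_filter.2 ⟨hIJ (Finset.mem_filter.1 hz).1, (Finset.mem_filter.1 hz).2⟩
    have h1 : glue x y I hI ⟨p, hp⟩ = y.1 (I.right hI) ⟨p, gap_right I hI hp h⟩ := dif_neg h
    have hsp := le_of_gap hI hp h
    rw [h1, ← y.2 _ _ hR]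
    refine compose_congr _ _ _ _ _ _ _ _ rfl ?_ ?_
    · intro z hz _
      exact ⟨fun hzJ => Finset.mem_filter.2 ⟨hzJ, hsp.trans hz⟩,
        fun hz => (Finset.mem_filter.1 hz).1⟩
    · intro q hq hq' hq1 _
      exact dif_neg (not_le.2 ((hsp.trans hq1).trans_lt (lt_of_mem_gaps hq)))

/-- The thread over `[r, t]` whose coordinate at each partition `I` containing `s` is
`(x_{I ∩ [r, s]}, y_{I ∩ [s, t]})`. Its coordinate at an arbitrary `I` is the image under the
connecting map of its coordinate at `I ∪ {s}`. -/
noncomputable def flatMulFun (h : 𝒮.IsConvergent) {r s t : S} (hrs : r ≤ s) (hst : s ≤ t)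
    (x : (𝒮.partitionSystem r s).Thread) (y : (𝒮.partitionSystem s t).Thread) :
    (𝒮.partitionSystem r t).Thread :=
  ⟨fun I => (𝒮.partitionSystem r t).map (I.le_add hrs hst)
      (glue x y (I.add hrs hst) (I.mem_add hrs hst)), by
    intro I J hIJ
    have hmm := (h.partitionSystem (hrs.trans hst)).simplyMaximal
    have hIJ' : I.add hrs hst ≤ J.add hrs hst := Finset.insert_subset_insert s hIJ
    have h1 := map_glue x y hIJ' (I.mem_add hrs hst) (J.mem_add hrs hst)
    exact (hmm.map_map _ _ _).trans ((hmm.map_map _ hIJ' _).symm.trans (congrArg _ h1))⟩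

/-- The defining relation of the multiplication of the projective limits: at a partition `I`
containing `s`, it is the product of the coordinates at `I ∩ [r, s]` and at `I ∩ [s, t]`. -/
theorem flatMulFun_apply (h : 𝒮.IsConvergent) {r s t : S} (hrs : r ≤ s) (hst : s ≤ t)
    (x : (𝒮.partitionSystem r s).Thread) (y : (𝒮.partitionSystem s t).Thread)
    (I : IntervalPartition r t) (hs : s ∈ I.1) :
    (flatMulFun h hrs hst x y).1 I = glue x y I hs :=
  map_glue x y (I.le_add hrs hst) hs (I.mem_add hrs hst)

/-- The left factor of a thread over `[r, t]`. -/
def leftPart {r s t : S} (hst : s ≤ t) (z : (𝒮.partitionSystem r t).Thread) :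
    (𝒮.partitionSystem r s).Thread :=
  ⟨fun I p => z.1 (I.addRight hst) ⟨p.1, gap_addRight I hst p.2⟩, by
    intro I J hIJ
    funext ⟨p, hp⟩
    have hIJ' : I.addRight hst ≤ J.addRight hst := Finset.insert_subset_insert t hIJ
    refine Eq.trans ?_ (congrFun (z.2 _ _ hIJ') ⟨p, gap_addRight I hst hp⟩)
    have hps : p.2 ≤ s := (I.2.2.2 _ (mem_gaps.1 hp).1.2).2
    refine compose_congr _ _ _ _ _ _ _ _ rfl ?_ fun _ _ _ _ _ => rfl
    intro x _ hx
    refine ⟨Finset.mem_insert_of_mem, fun hx' => ?_⟩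
    rcases Finset.mem_insert.1 hx' with rfl | hx'
    · rw [le_antisymm (hx.trans hps) hst]
      exact J.2.2.1
    · exact hx'⟩

/-- The right factor of a thread over `[r, t]`. -/
def rightPart {r s t : S} (hrs : r ≤ s) (z : (𝒮.partitionSystem r t).Thread) :
    (𝒮.partitionSystem s t).Thread :=
  ⟨fun I p => z.1 (I.addLeft hrs) ⟨p.1, gap_addLeft I hrs p.2⟩, by
    intro I J hIJ
    funext ⟨p, hp⟩
    have hIJ' : I.addLeft hrs ≤ J.addLeft hrs := Finset.insert_subset_insert r hIJ
    refine Eq.trans ?_ (congrFun (z.2 _ _ hIJ') ⟨p, gap_addLeft I hrs hp⟩)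
    have hps : s ≤ p.1 := (I.2.2.2 _ (mem_gaps.1 hp).1.1).1
    refine compose_congr _ _ _ _ _ _ _ _ rfl ?_ fun _ _ _ _ _ => rfl
    intro x hx _
    refine ⟨Finset.mem_insert_of_mem, fun hx' => ?_⟩
    rcases Finset.mem_insert.1 hx' with rfl | hx'
    · rw [le_antisymm hrs (hps.trans hx)]
      exact J.2.1
    · exact hx'⟩

/-- The multiplication `T♭ r s t : Ω♭ r s × Ω♭ s t → Ω♭ r t` of the projective limits, as a
measurable bijection with measurable inverse. It is determined by the relation
`(T♭ r s t (x, y))_I = (x_{I ∩ [r, s]}, y_{I ∩ [s, t]})` for all partitions `I` of `[r, t]` that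
contain `s`. For `r = s` or `s = t`, one factor is a one-point space and the map is the
identification of the product with the other factor. -/
noncomputable def flatMul (h : 𝒮.IsConvergent) {r s t : S} (hrs : r ≤ s) (hst : s ≤ t) :
    (𝒮.flat h hrs × 𝒮.flat h hst) ≃ᵐ 𝒮.flat h (hrs.trans hst) where
  toFun p := flatMulFun h hrs hst p.1 p.2
  invFun z := (leftPart hst z, rightPart hrs z)
  left_inv := by
    rintro ⟨x, y⟩
    refine Prod.ext (Subtype.ext ?_) (Subtype.ext ?_)
    · funext I ⟨p, hp⟩
      have hs : s ∈ (I.addRight hst).1 := Finset.mem_insert_of_mem I.2.2.1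
      have hps : p.2 ≤ s := (I.2.2.2 _ (mem_gaps.1 hp).1.2).2
      change (flatMulFun h hrs hst x y).1 (I.addRight hst) ⟨p, gap_addRight I hst hp⟩ = _
      rw [flatMulFun_apply h hrs hst x y _ hs]
      refine (dif_pos hps).trans (thread_gap x (J := (I.addRight hst).left hs) ?_ hp _).symm
      exact fun z hz => Finset.mem_filter.2 ⟨Finset.mem_insert_of_mem hz, (I.2.2.2 z hz).2⟩
    · funext I ⟨p, hp⟩
      have hs : s ∈ (I.addLeft hrs).1 := Finset.mem_insert_of_mem I.2.1
      have hps : s ≤ p.1 := (I.2.2.2 _ (mem_gaps.1 hp).1.1).1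
      change (flatMulFun h hrs hst x y).1 (I.addLeft hrs) ⟨p, gap_addLeft I hrs hp⟩ = _
      rw [flatMulFun_apply h hrs hst x y _ hs]
      refine (dif_neg (not_le.2 (hps.trans_lt (lt_of_mem_gaps hp)))).trans
        (thread_gap y (J := (I.addLeft hrs).right hs) ?_ hp _).symm
      exact fun z hz => Finset.mem_filter.2 ⟨Finset.mem_insert_of_mem hz, (I.2.2.2 z hz).1⟩
  right_inv := by
    intro z
    refine Subtype.ext ?_
    funext I
    refine Eq.trans ?_ (z.2 I (I.add hrs hst) (I.le_add hrs hst))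
    refine congrArg ((𝒮.partitionSystem r t).map (I.le_add hrs hst)) ?_
    funext ⟨p, hp⟩
    by_cases hps : p.2 ≤ s
    · refine (dif_pos hps).trans (thread_gap z ?_ _ hp)
      intro w hw
      rcases Finset.mem_insert.1 hw with rfl | hw
      · exact (I.add hrs hst).2.2.1
      · exact (Finset.mem_filter.1 hw).1
    · refine (dif_neg hps).trans (thread_gap z ?_ _ hp)
      intro w hw
      rcases Finset.mem_insert.1 hw with rfl | hw
      · exact (I.add hrs hst).2.1
      · exact (Finset.mem_filter.1 hw).1
  measurable_toFun := by
    refine Measurable.subtype_mk (measurable_pi_iff.2 fun I => ?_)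
    refine (measurable_partitionSystem_map (I.le_add hrs hst)).comp (measurable_pi_iff.2 ?_)
    intro p
    by_cases hps : p.1.2 ≤ s
    · simp only [glue, dif_pos hps]
      exact (measurable_pi_apply _).comp ((measurable_pi_apply _).comp
        (measurable_subtype_coe.comp measurable_fst))
    · simp only [glue, dif_neg hps]
      exact (measurable_pi_apply _).comp ((measurable_pi_apply _).comp
        (measurable_subtype_coe.comp measurable_snd))
  measurable_invFun := by
    refine Measurable.prodMk ?_ ?_
    · refine Measurable.subtype_mk (measurable_pi_iff.2 fun I => measurable_pi_iff.2 fun p => ?_)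
      exact (measurable_pi_apply _).comp ((measurable_pi_apply _).comp measurable_subtype_coe)
    · refine Measurable.subtype_mk (measurable_pi_iff.2 fun I => measurable_pi_iff.2 fun p => ?_)
      exact (measurable_pi_apply _).comp ((measurable_pi_apply _).comp measurable_subtype_coe)

/-- For `u ≤ s ≤ t ≤ v`, the map
`T♭ (s,t) (u,v) = π ∘ (id × T♭ s t v)⁻¹ ∘ (T♭ u s v)⁻¹ : Ω♭ u v → Ω♭ s t`, where
`π : Ω♭ u s × Ω♭ s t × Ω♭ t v → Ω♭ s t` is the projection onto the middle factor. -/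
noncomputable def flatMap (h : 𝒮.IsConvergent) {x s t y : S} (hxs : x ≤ s) (hst : s ≤ t)
    (hty : t ≤ y) : 𝒮.flat h (hxs.trans (hst.trans hty)) → 𝒮.flat h hst :=
  (fun p : 𝒮.flat h hxs × 𝒮.flat h hst × 𝒮.flat h hty => p.2.1) ∘
    ((MeasurableEquiv.refl (𝒮.flat h hxs)).prodCongr (flatMul h hst hty)).symm ∘
    (flatMul h hxs (hst.trans hty)).symm

/-- The system of the spaces `Ω♭ s t` and the maps `T♭ (s,t) (u,v)`, over the set of all pairs
`(s, t)` with `s ≤ t`, ordered by `(s, t) ≤ (u, v)` if and only if `u ≤ s` and `t ≤ v`. -/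
noncomputable def flatSystem (h : 𝒮.IsConvergent) : ProbSystem.{max u v} (NonemptyInterval S) where
  space i := 𝒮.flat h i.fst_le_snd
  map {i _} hij := flatMap h (NonemptyInterval.le_def.1 hij).1 i.fst_le_snd
    (NonemptyInterval.le_def.1 hij).2

end ConvolutionSystem

open ProbabilityTheory in
/-- Forgetting coordinates maps a finite product of probability measures to the product of the
remaining ones. -/
theorem measurePreserving_pi_comp {α β : Type*} [Fintype α] [Fintype β] {X : β → Type*}
    [∀ b, MeasurableSpace (X b)] (μ : ∀ b, Measure (X b)) [∀ b, IsProbabilityMeasure (μ b)]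
    {e : α → β} (he : Function.Injective e) :
    MeasurePreserving (fun (x : ∀ b, X b) a => x (e a)) (Measure.pi μ)
      (Measure.pi fun a => μ (e a)) := by
  refine ⟨measurable_pi_iff.2 fun a => measurable_pi_apply _, ?_⟩
  have hind : iIndepFun (fun b (x : ∀ b, X b) => x b) (Measure.pi μ) :=
    iIndepFun_pi (X := fun _ y => y) fun _ => aemeasurable_id
  rw [(iIndepFun_iff_map_fun_eq_pi_map fun a => (measurable_pi_apply (e a)).aemeasurable).1
    (hind.precomp he)]
  congr 1
  funext a
  exact (measurePreserving_eval μ (e a)).map_eq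

namespace ProbSystem

variable {ι : Type w} [Preorder ι] [IsDirectedOrder ι]

/-- Over a nonempty index set, two probability measures on the set of threads agree if they agree
on the cylinder sets. -/
theorem measure_thread_ext [Nonempty ι] (P : ProbSystem.{v} ι)
    (hm : ∀ {i j : ι} (hij : i ≤ j), Measurable (P.map hij)) {μ ν : Measure P.Thread}
    (hμ : IsProbabilityMeasure μ) (hν : IsProbabilityMeasure ν)
    (h : ∀ (i : ι) (A : Set (P.space i)), MeasurableSet A →
      μ (P.proj i ⁻¹' A) = ν (P.proj i ⁻¹' A)) : μ = ν := by
  refine ext_of_generate_finite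
    {s | ∃ (i : ι) (A : Set (P.space i)), MeasurableSet A ∧ s = P.proj i ⁻¹' A} ?_ ?_ ?_
    (by rw [measure_univ, measure_univ])
  · refine le_antisymm ?_ (MeasurableSpace.generateFrom_le ?_)
    · change MeasurableSpace.comap Subtype.val (⨆ i, MeasurableSpace.comap _ _) ≤ _
      rw [MeasurableSpace.comap_iSup]
      refine iSup_le fun i => ?_
      rw [MeasurableSpace.comap_comp]
      rintro _ ⟨A, hA, rfl⟩
      exact MeasurableSpace.measurableSet_generateFrom ⟨i, A, hA, rfl⟩
    · rintro _ ⟨i, A, hA, rfl⟩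
      exact P.measurable_proj i hA
  · rintro _ ⟨i, A, hA, rfl⟩ _ ⟨j, B, hB, rfl⟩ _
    obtain ⟨k, hik, hjk⟩ := exists_ge_ge i j
    refine ⟨k, P.map hik ⁻¹' A ∩ P.map hjk ⁻¹' B, (hm hik hA).inter (hm hjk hB), ?_⟩
    ext ω
    simp only [Set.mem_inter_iff, Set.mem_preimage, map_proj]
  · rintro _ ⟨i, A, hA, rfl⟩
    exact h i A hA

end ProbSystem

namespace ConvolutionSystem

open IntervalPartition

variable {S : Type u} [LinearOrder S] {𝒮 : ConvolutionSystem.{u, v} S}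

theorem measurable_flatMap (h : 𝒮.IsConvergent) {x s t y : S} (hxs : x ≤ s) (hst : s ≤ t)
    (hty : t ≤ y) : Measurable (flatMap h hxs hst hty) :=
  (measurable_fst.comp measurable_snd).comp
    ((MeasurableEquiv.measurable _).comp (MeasurableEquiv.measurable _))

theorem measurePreserving_flatMap (h : 𝒮.IsConvergent) {x s t y : S} (hxs : x ≤ s) (hst : s ≤ t)
    (hty : t ≤ y) : MeasurePreserving (flatMap h hxs hst hty)
      (𝒮.flat h (hxs.trans (hst.trans hty))).measure (𝒮.flat h hst).measure := by
  have hmeas := measurable_flatMap h hxs hst hty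
  refine ⟨hmeas, ?_⟩
  have : Nonempty (IntervalPartition s t) :=
    ⟨⟨{s, t}, by simp, by simp, by simp [hst]⟩⟩
  have hprob := Measure.isProbabilityMeasure_map
    (μ := (𝒮.flat h (hxs.trans (hst.trans hty))).measure) hmeas.aemeasurable
  refine ProbSystem.measure_thread_ext (𝒮.partitionSystem s t) measurable_partitionSystem_map
    hprob (𝒮.flat h hst).isProbabilityMeasure fun I A hA => ?_
  let e : gaps I.1 → gaps ((I.addRight hty).addLeft hxs).1 := fun p =>
    ⟨p.1, gap_addLeft _ hxs (gap_addRight I hty p.2)⟩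
  have he : Function.Injective e := fun p q hpq =>
    Subtype.ext (Subtype.mk.inj hpq)
  have hpi := measurePreserving_pi_comp
    (fun p : gaps ((I.addRight hty).addLeft hxs).1 => (𝒮.space (lt_of_mem_gaps p.2)).measure) he
  have hlim := ProbSystem.limit_measure (𝒮.partitionSystem x y) measurable_partitionSystem_map
    (h.partitionSystem (hxs.trans (hst.trans hty))) ((I.addRight hty).addLeft hxs) _
    (hpi.measurable hA)
  exact (Measure.map_apply hmeas ((𝒮.partitionSystem s t).measurable_proj I hA)).trans
    (hlim.trans ((hpi.measure_preimage hA.nullMeasurableSet).trans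
      (ProbSystem.limit_measure (𝒮.partitionSystem s t) measurable_partitionSystem_map
        (h.partitionSystem hst) I A hA).symm))

theorem flatMap_comp (h : 𝒮.IsConvergent) {x x' s t y' y : S} (hx : x ≤ x') (hxs : x' ≤ s)
    (hst : s ≤ t) (hty : t ≤ y') (hy : y' ≤ y) (z : (𝒮.partitionSystem x y).Thread) :
    flatMap h hxs hst hty (flatMap h hx (hxs.trans (hst.trans hty)) hy z) =
      flatMap h (hx.trans hxs) hst (hty.trans hy) z := by
  refine Subtype.ext (funext fun I => funext fun p => ?_)
  refine (thread_gap z (I := (I.addRight (hty.trans hy)).addLeft (hx.trans hxs))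
    (J := (((I.addRight hty).addLeft hxs).addRight hy).addLeft hx) ?_ _ _).symm
  intro a ha
  simp only [addLeft, addRight, Finset.mem_insert] at ha ⊢
  tauto

theorem flatMap_refl (h : 𝒮.IsConvergent) {s t : S} (hst : s ≤ t)
    (z : (𝒮.partitionSystem s t).Thread) :
    flatMap h (le_refl s) hst (le_refl t) z = z := by
  refine Subtype.ext (funext fun I => funext fun p => ?_)
  refine (thread_gap z (I := I) (J := (I.addRight (le_refl t)).addLeft (le_refl s)) ?_
    p.2 _).symm
  exact fun a ha => Finset.mem_insert_of_mem (Finset.mem_insert_of_mem ha)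

end ConvolutionSystem

theorem proposition4p4 {S : Type u} [LinearOrder S] (𝒮 : ConvolutionSystem.{u, v} S)
    (h : 𝒮.IsConvergent) : (ConvolutionSystem.flatSystem h).IsProjective := by
  refine ⟨fun {i j} hij => ?_, fun {i j k} hij hjk => funext fun z => ?_,
    fun i => funext fun z => ?_⟩
  · exact ConvolutionSystem.measurePreserving_flatMap h (NonemptyInterval.le_def.1 hij).1
      i.fst_le_snd (NonemptyInterval.le_def.1 hij).2
  · exact ConvolutionSystem.flatMap_comp h (NonemptyInterval.le_def.1 hjk).1
      (NonemptyInterval.le_def.1 hij).1 i.fst_le_snd (NonemptyInterval.le_def.1 hij).2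
      (NonemptyInterval.le_def.1 hjk).2 z
  · exact ConvolutionSystem.flatMap_refl h i.fst_le_snd z
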